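/- Let $(\alpha_n)_{n\ge 0}$ be the sequence of pseudo-factorials, i.e. the integers determined by \[ \alpha_0=1,\qquad \alpha_{n+1}=(-1)^{n+1}\sum_{k=0}^{n}\binom nk\,\alpha_k\,\alpha_{n-k}\quad(n\ge 0), \] and put $a_j=-j^2\,(2-(-1)^j)$ for $j\ge 1$. Then for every positive integer $m$ the Hankel determinant $H_m^{(0)}=\det(\alpha_{i+j})_{0\le i,j<m}$ satisfies \[ H_m^{(0)}=\prod_{j=1}^{m-1}a_j^{\,m-j} =(-1)^{\lfloor m/2\rfloor}\,3^{\lfloor m^2/4\rfloor}\Bigl(\prod_{k=1}^{m-1}k!\Bigr)^2 . \] -/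

import Mathlib

/-!
The exponential generating function `F` of the pseudo-factorials and its reflection `G(x) = F(-x)`
satisfy `F' = -G²` and `G' = F²`, hence `F³ + G³ = 2`. With `u = 1 - F G`, which vanishes at `0`,
the Fermat cubic turns differentiation into a three-term recurrence on the sequence
`F, G² - F, F u, (G² - F) u, F u², …`, of which only the first term has a nonzero constant
coefficient. As `αₙ` is the constant coefficient of the `n`-th derivative of `F`, iterating the
recurrence exhibits `αₙ` as the first column of a Stieltjes matrix `S`, the transfer matrix of a
Jacobi continued fraction with numerators `aⱼ`. A tridiagonal operator is symmetric for the weights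
`a₁ ⋯ aₖ`, so the Hankel matrix is `S diag(a₁ ⋯ aₖ) Sᵀ` with `S` unitriangular.
-/

/-- The pseudo-factorials: `α 0 = 1` and
`α (n+1) = (-1)^(n+1) * ∑_{k=0}^{n} (n choose k) * α k * α (n-k)`.
The sum is indexed by `Fin (n+1)` so that the recursive calls are visibly decreasing. -/
def pseudoFactorial : ℕ → ℤ
  | 0 => 1
  | n + 1 => (-1) ^ (n + 1) *
      ∑ k : Fin (n + 1),
        (n.choose (k : ℕ) : ℤ) * pseudoFactorial (k : ℕ) * pseudoFactorial (n - (k : ℕ))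
termination_by n => n
decreasing_by
  · exact k.isLt
  · omega

theorem pseudoFactorial_zero : pseudoFactorial 0 = 1 := by
  rw [pseudoFactorial]

theorem pseudoFactorial_succ (n : ℕ) :
    pseudoFactorial (n + 1) = (-1) ^ (n + 1) *
      ∑ k ∈ Finset.range (n + 1),
        (n.choose k : ℤ) * pseudoFactorial k * pseudoFactorial (n - k) := by
  rw [pseudoFactorial, Finset.sum_range]

/-- The coefficients `a_j = -j² (2 - (-1)^j)`: `-3·1², -2², -3·3², -4², …` for `j = 1, 2, 3, 4, …`. -/
def fractionNumerator (j : ℕ) : ℤ := -(j : ℤ) ^ 2 * (2 - (-1) ^ j)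

/-- The `m × m` Hankel matrix `(α_{i+j})_{0 ≤ i, j < m}` of the pseudo-factorials. -/
def pseudoFactorialHankel (m : ℕ) : Matrix (Fin m) (Fin m) ℤ :=
  Matrix.of fun i j => pseudoFactorial ((i : ℕ) + (j : ℕ))

open PowerSeries

section ProductIdentities

theorem prod_range_prod_Icc {M : Type*} [CommMonoid M] (f : ℕ → M) (m : ℕ) :
    ∏ k ∈ Finset.range m, ∏ j ∈ Finset.Icc 1 k, f j =
      ∏ j ∈ Finset.Icc 1 (m - 1), f j ^ (m - j) := by
  have swap (k j : ℕ) : k ∈ Finset.range m ∧ j ∈ Finset.Icc 1 k ↔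
      k ∈ Finset.Ico j m ∧ j ∈ Finset.Icc 1 (m - 1) := by
    simp only [Finset.mem_range, Finset.mem_Icc, Finset.mem_Ico]
    omega
  rw [Finset.prod_comm' swap]
  simp only [Finset.prod_const, Nat.card_Ico]

theorem prod_range_neg_one_pow {M : Type*} [CommMonoid M] [HasDistribNeg M] (m : ℕ) :
    ∏ k ∈ Finset.range m, (-1 : M) ^ k = (-1) ^ (m / 2) := by
  induction m with
  | zero => simp
  | succ m ih =>
    rw [Finset.prod_range_succ, ih, ← pow_add,
      show m / 2 + m = (m + 1) / 2 + 2 * (m / 2) by omega, pow_add, pow_mul]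
    simp

theorem sum_range_succ_div_two (m : ℕ) :
    ∑ k ∈ Finset.range m, (k + 1) / 2 = m ^ 2 / 4 := by
  induction m with
  | zero => simp
  | succ m ih =>
    rw [Finset.sum_range_succ, ih]
    rcases Nat.even_or_odd' m with ⟨r, rfl | rfl⟩ <;> ring_nf <;> omega

theorem prod_range_factorial {m : ℕ} (hm : 0 < m) :
    ∏ k ∈ Finset.range m, k.factorial = ∏ k ∈ Finset.Icc 1 (m - 1), k.factorial := by
  rw [Nat.prod_Icc_factorial, ← Nat.prod_range_succ_factorial, Nat.sub_add_cancel hm]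

end ProductIdentities

section StieltjesMatrix

/-- The Stieltjes matrix of the Jacobi continued fraction with linear coefficients `b 0, b 1, …`
and numerators `a 1, a 2, …`; the value `a 0` is junk. Its `(n, k)` entry is the total weight of the
Motzkin paths from height `0` to height `k` in `n` steps, where a level step at height `j` weighs
`b j` and a step down from height `j` weighs `a j`. -/
def stieltjesMatrix {R : Type*} [Semiring R] (b a : ℕ → R) : ℕ → ℕ → R
  | 0, 0 => 1
  | 0, _ + 1 => 0
  | n + 1, 0 => b 0 * stieltjesMatrix b a n 0 + a 1 * stieltjesMatrix b a n 1
  | n + 1, k + 1 => stieltjesMatrix b a n k + b (k + 1) * stieltjesMatrix b a n (k + 1) +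
      a (k + 2) * stieltjesMatrix b a n (k + 2)

section Semiring

variable {R : Type*} [Semiring R] (b a : ℕ → R)

theorem stieltjesMatrix_of_lt {n k : ℕ} (h : n < k) : stieltjesMatrix b a n k = 0 := by
  induction n generalizing k with
  | zero =>
    obtain ⟨k, rfl⟩ := Nat.exists_eq_add_one.mpr h
    rfl
  | succ n ih =>
    obtain ⟨k, rfl⟩ := Nat.exists_eq_add_one.mpr (Nat.zero_lt_of_lt h)
    simp [stieltjesMatrix, ih (show n < k by omega), ih (show n < k + 1 by omega),
      ih (show n < k + 2 by omega)]

theorem stieltjesMatrix_self (n : ℕ) : stieltjesMatrix b a n n = 1 := by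
  induction n with
  | zero => rfl
  | succ n ih =>
    simp [stieltjesMatrix, ih, stieltjesMatrix_of_lt b a (show n < n + 1 by omega),
      stieltjesMatrix_of_lt b a (show n < n + 2 by omega)]

end Semiring

theorem map_pow_apply_of_three_term {R M N : Type*} [CommSemiring R]
    [AddCommMonoid M] [AddCommMonoid N] [Module R M] [Module R N]
    (D : Module.End R M) (φ : M →ₗ[R] N) {p : ℕ → M} {b c d : ℕ → R}
    (hD_zero : D (p 0) = b 0 • p 0 + d 1 • p 1)
    (hD_succ : ∀ k, D (p (k + 1)) =
      c (k + 1) • p k + b (k + 1) • p (k + 1) + d (k + 2) • p (k + 2))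
    (hφ : ∀ k, φ (p (k + 1)) = 0) (n k : ℕ) :
    φ ((D ^ n) (p k)) =
      ((∏ j ∈ Finset.Icc 1 k, c j) * stieltjesMatrix b (fun j => c j * d j) n k) • φ (p 0) := by
  have prod_succ (k : ℕ) := Finset.prod_Icc_succ_top (show 1 ≤ k + 1 by omega) c
  induction n generalizing k with
  | zero => cases k <;> simp [stieltjesMatrix, hφ]
  | succ n ih =>
    rw [pow_succ, Module.End.mul_apply]
    cases k with
    | zero =>
      simp only [hD_zero, map_add, map_smul, ih, smul_smul, ← add_smul]
      congr 1
      simp only [stieltjesMatrix, prod_succ, Finset.Icc_eq_empty_of_lt one_pos, Finset.prod_empty]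
      ring
    | succ k =>
      simp only [hD_succ, map_add, map_smul, ih, smul_smul, ← add_smul]
      congr 1
      simp only [stieltjesMatrix, prod_succ]
      ring

section CommRing

variable {R : Type*} [CommRing R] (b a : ℕ → R)

/- The tridiagonal operator advancing the rows is symmetric for the weights `a 1 ⋯ a k`, so
summation by parts leaves only a boundary term, as in the Christoffel–Darboux formula. -/
theorem sum_range_stieltjesMatrix_succ_sub (i j N : ℕ) :
    ∑ k ∈ Finset.range (N + 1), (∏ l ∈ Finset.Icc 1 k, a l) *
        (stieltjesMatrix b a (i + 1) k * stieltjesMatrix b a j k -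
          stieltjesMatrix b a i k * stieltjesMatrix b a (j + 1) k) =
      (∏ l ∈ Finset.Icc 1 (N + 1), a l) *
        (stieltjesMatrix b a i (N + 1) * stieltjesMatrix b a j N -
          stieltjesMatrix b a i N * stieltjesMatrix b a j (N + 1)) := by
  induction N with
  | zero =>
    simp only [stieltjesMatrix, zero_add, Finset.sum_range_one, Finset.Icc_self,
      Finset.prod_singleton, Finset.Icc_eq_empty_of_lt one_pos, Finset.prod_empty]
    ring
  | succ N ih =>
    rw [Finset.sum_range_succ, ih, Finset.prod_Icc_succ_top (show 1 ≤ N + 1 + 1 by omega)]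
    simp only [stieltjesMatrix]
    ring

theorem sum_range_stieltjesMatrix_mul_stieltjesMatrix {i N : ℕ} (hi : i < N) (j : ℕ) :
    ∑ k ∈ Finset.range N, (∏ l ∈ Finset.Icc 1 k, a l) *
        (stieltjesMatrix b a i k * stieltjesMatrix b a j k) =
      stieltjesMatrix b a (i + j) 0 := by
  obtain ⟨N, rfl⟩ := Nat.exists_eq_add_one.mpr (Nat.zero_lt_of_lt hi)
  induction i generalizing j with
  | zero =>
    rw [Finset.sum_range_succ']
    simp [stieltjesMatrix]
  | succ i ih =>
    have shift := sum_range_stieltjesMatrix_succ_sub b a i j N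
    rw [stieltjesMatrix_of_lt b a (show i < N + 1 by omega),
      stieltjesMatrix_of_lt b a (show i < N by omega)] at shift
    simp only [mul_sub, Finset.sum_sub_distrib, zero_mul, mul_zero, sub_zero, sub_eq_zero] at shift
    rw [shift, ih _ (by omega), Nat.add_right_comm, Nat.add_assoc]

theorem det_hankel_stieltjesMatrix (m : ℕ) :
    (Matrix.of fun i j : Fin m => stieltjesMatrix b a (i + j) 0).det =
      ∏ k ∈ Finset.range m, ∏ j ∈ Finset.Icc 1 k, a j := by
  let S : Matrix (Fin m) (Fin m) R := Matrix.of fun n k => stieltjesMatrix b a n k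
  let weights : Fin m → R := fun k => ∏ j ∈ Finset.Icc 1 (k : ℕ), a j
  have det_S : S.det = 1 := by
    rw [Matrix.det_of_isLowerTriangular S fun _ _ hlt => stieltjesMatrix_of_lt b a hlt]
    exact Finset.prod_eq_one fun n _ => stieltjesMatrix_self b a n
  have factorization : (Matrix.of fun i j : Fin m => stieltjesMatrix b a (i + j) 0) =
      S * Matrix.diagonal weights * S.transpose := by
    ext i j
    rw [Matrix.mul_apply]
    simp only [Matrix.mul_diagonal, Matrix.transpose_apply, Matrix.of_apply, S, weights]
    rw [← sum_range_stieltjesMatrix_mul_stieltjesMatrix b a i.isLt, Finset.sum_range]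
    exact Finset.sum_congr rfl fun k _ => by ring
  rw [factorization, Matrix.det_mul, Matrix.det_mul, Matrix.det_transpose, det_S,
    Matrix.det_diagonal, one_mul, mul_one, Finset.prod_range]

end CommRing

end StieltjesMatrix

section FermatCubic

/-- The sequence `f, g² - f, f u, (g² - f) u, f u², …` with `u = 1 - f g`, which satisfies a
three-term recurrence under a derivation with `f' = -g²` and `g' = f²` on the Fermat cubic
`f³ + g³ = 2`. -/
def fermatSeq {A : Type*} [CommRing A] (f g : A) (k : ℕ) : A :=
  (if Even k then f else g ^ 2 - f) * (1 - f * g) ^ (k / 2)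

/-- The linear coefficients `-1, 1, -3, 3, -5, 5, …` of the Jacobi continued fraction whose
numerators are `fractionNumerator`. -/
def fractionLinear (k : ℕ) : ℤ := (-1) ^ (k + 1) * (2 * (k / 2 : ℕ) + 1)

variable {A : Type*} [CommRing A] (f g : A)

theorem fermatSeq_two_mul (r : ℕ) : fermatSeq f g (2 * r) = f * (1 - f * g) ^ r := by
  simp [fermatSeq]

theorem fermatSeq_two_mul_add_one (r : ℕ) :
    fermatSeq f g (2 * r + 1) = (g ^ 2 - f) * (1 - f * g) ^ r := by
  simp [fermatSeq, show (2 * r + 1) / 2 = r by omega]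

variable {f g}

theorem map_fermatSeq_succ_eq_zero {B : Type*} [Ring B] (φ : A →+* B) (hf : φ f = 1)
    (hg : φ g = 1) (k : ℕ) : φ (fermatSeq f g (k + 1)) = 0 := by
  rcases Nat.even_or_odd' k with ⟨r, rfl | rfl⟩
  · simp [fermatSeq_two_mul_add_one, hf, hg]
  · rw [show 2 * r + 1 + 1 = 2 * (r + 1) by ring]
    simp [fermatSeq_two_mul, hf, hg]

variable {R : Type*} [CommSemiring R] [Algebra R A] (D : Derivation R A A)

theorem derivation_cube_add_cube (hf : D f = -g ^ 2) (hg : D g = f ^ 2) :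
    D (f ^ 3 + g ^ 3) = 0 := by
  simp only [map_add, Derivation.leibniz_pow, hf, hg, smul_eq_mul, nsmul_eq_mul]
  push_cast
  ring

theorem derivation_one_sub_mul_pow (hf : D f = -g ^ 2) (hg : D g = f ^ 2) (k : ℕ) :
    D ((1 - f * g) ^ k) = k * (1 - f * g) ^ (k - 1) * (g ^ 3 - f ^ 3) := by
  simp only [Derivation.leibniz_pow, Derivation.leibniz, map_sub, Derivation.map_one_eq_zero, hf,
    hg, smul_eq_mul, nsmul_eq_mul]
  ring

theorem derivation_fermatSeq_zero (hf : D f = -g ^ 2) :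
    D (fermatSeq f g 0) = -fermatSeq f g 0 - fermatSeq f g 1 := by
  simp only [fermatSeq_two_mul f g 0, fermatSeq_two_mul_add_one f g 0, pow_zero, mul_one, hf]
  ring

theorem derivation_fermatSeq_two_mul_add_one (hf : D f = -g ^ 2) (hg : D g = f ^ 2)
    (h : f ^ 3 + g ^ 3 = 2) (r : ℕ) :
    D (fermatSeq f g (2 * r + 1)) =
      3 * (2 * r + 1) * fermatSeq f g (2 * r) + (2 * r + 1) * fermatSeq f g (2 * r + 1) -
        (2 * r + 2) * fermatSeq f g (2 * r + 2) := by
  rw [show 2 * r + 2 = 2 * (r + 1) by ring]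
  simp only [fermatSeq_two_mul, fermatSeq_two_mul_add_one, Derivation.leibniz,
    derivation_one_sub_mul_pow D hf hg, map_sub, Derivation.leibniz_pow, hf, hg, smul_eq_mul,
    nsmul_eq_mul]
  cases r with
  | zero =>
    push_cast
    ring
  | succ r =>
    rw [Nat.add_sub_cancel]
    push_cast
    linear_combination ((r + 1) * (g ^ 2 + f) * (1 - f * g) ^ r) * h

theorem derivation_fermatSeq_two_mul_add_two (hf : D f = -g ^ 2) (hg : D g = f ^ 2)
    (h : f ^ 3 + g ^ 3 = 2) (r : ℕ) :
    D (fermatSeq f g (2 * r + 2)) =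
      (2 * r + 2) * fermatSeq f g (2 * r + 1) - (2 * r + 3) * fermatSeq f g (2 * r + 2) -
        (2 * r + 3) * fermatSeq f g (2 * r + 3) := by
  rw [show 2 * r + 2 = 2 * (r + 1) by ring, show 2 * r + 3 = 2 * (r + 1) + 1 by ring]
  simp only [fermatSeq_two_mul, fermatSeq_two_mul_add_one, Derivation.leibniz,
    derivation_one_sub_mul_pow D hf hg, hf, smul_eq_mul, Nat.add_sub_cancel]
  push_cast
  linear_combination (-(r + 1) * f * (1 - f * g) ^ r) * h

theorem derivation_fermatSeq_succ (hf : D f = -g ^ 2) (hg : D g = f ^ 2)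
    (h : f ^ 3 + g ^ 3 = 2) (k : ℕ) :
    D (fermatSeq f g (k + 1)) =
      (((k + 1 : ℕ) : ℤ) * (2 - (-1) ^ (k + 1))) • fermatSeq f g k +
        fractionLinear (k + 1) • fermatSeq f g (k + 1) +
        (-((k + 2 : ℕ) : ℤ)) • fermatSeq f g (k + 2) := by
  rcases Nat.even_or_odd' k with ⟨r, rfl | rfl⟩
  · have half : (2 * r + 1) / 2 = r := by omega
    have sign : (-1 : ℤ) ^ (2 * r + 1) = -1 := Odd.neg_one_pow ⟨r, rfl⟩
    rw [derivation_fermatSeq_two_mul_add_one D hf hg h, fractionLinear, half, pow_succ _ (_ + 1),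
      sign]
    simp only [zsmul_eq_mul]
    push_cast
    ring
  · have half : (2 * r + 1 + 1) / 2 = r + 1 := by omega
    have sign : (-1 : ℤ) ^ (2 * r + 1 + 1) = 1 := Even.neg_one_pow ⟨r + 1, by ring⟩
    rw [derivation_fermatSeq_two_mul_add_two D hf hg h, fractionLinear, half,
      pow_succ _ (_ + 1 + 1), sign]
    simp only [zsmul_eq_mul]
    push_cast
    ring

theorem map_iterate_derivation_eq_stieltjesMatrix {B : Type*} [Ring B] (φ : A →+* B)
    (hf : D f = -g ^ 2) (hg : D g = f ^ 2) (h : f ^ 3 + g ^ 3 = 2) (hφf : φ f = 1) (hφg : φ g = 1)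
    (n : ℕ) :
    φ (D^[n] f) = (stieltjesMatrix fractionLinear fractionNumerator n 0 : ℤ) := by
  let Dℤ : Module.End ℤ A := D.toLinearMap.toAddMonoidHom.toIntLinearMap
  let φℤ : A →ₗ[ℤ] B := φ.toAddMonoidHom.toIntLinearMap
  have fermatSeq_zero : fermatSeq f g 0 = f := by simpa using fermatSeq_two_mul f g 0
  have hD_zero : Dℤ (fermatSeq f g 0) =
      fractionLinear 0 • fermatSeq f g 0 + (-((1 : ℕ) : ℤ)) • fermatSeq f g 1 := by
    calc Dℤ (fermatSeq f g 0) = -fermatSeq f g 0 - fermatSeq f g 1 := derivation_fermatSeq_zero D hf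
      _ = _ := by simp [fractionLinear, sub_eq_add_neg]
  have numerator : (fun j : ℕ => (j : ℤ) * (2 - (-1) ^ j) * -(j : ℤ)) = fractionNumerator := by
    funext j
    rw [fractionNumerator]
    ring
  have moment : φℤ ((Dℤ ^ n) (fermatSeq f g 0)) =
      (1 * stieltjesMatrix fractionLinear _ n 0) • φℤ (fermatSeq f g 0) :=
    map_pow_apply_of_three_term Dℤ φℤ
      (c := fun j => (j : ℤ) * (2 - (-1) ^ j)) (d := fun j => -(j : ℤ)) hD_zero
      (derivation_fermatSeq_succ D hf hg h) (map_fermatSeq_succ_eq_zero φ hφf hφg) n 0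
  rw [numerator, fermatSeq_zero, Module.End.pow_apply, one_mul, zsmul_eq_mul] at moment
  calc φ (D^[n] f) = stieltjesMatrix fractionLinear fractionNumerator n 0 * φ f := moment
    _ = _ := by rw [hφf, mul_one]

end FermatCubic

section ExponentialGeneratingFunction

theorem derivative_rescale {R : Type*} [CommSemiring R] (r : R) (f : R⟦X⟧) :
    d⁄dX R (rescale r f) = r • rescale r (d⁄dX R f) := by
  ext n
  simp only [coeff_derivative, coeff_rescale, coeff_smul, smul_eq_mul]
  ring

/-- The exponential generating function `∑ aₙ xⁿ / n!` of a sequence. -/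
noncomputable def expGenFun {K : Type*} [Field K] (a : ℕ → K) : K⟦X⟧ :=
  mk fun n => a n / n.factorial

variable {K : Type*} [Field K]

theorem constantCoeff_expGenFun (a : ℕ → K) : constantCoeff (expGenFun a) = a 0 := by
  simp [expGenFun, ← coeff_zero_eq_constantCoeff_apply]

theorem rescale_expGenFun (r : K) (a : ℕ → K) :
    rescale r (expGenFun a) = expGenFun fun n => r ^ n * a n := by
  simp only [expGenFun, rescale_mk, mul_div_assoc]

variable [CharZero K]

theorem derivative_expGenFun (a : ℕ → K) :
    d⁄dX K (expGenFun a) = expGenFun fun n => a (n + 1) := by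
  ext n
  have := Nat.cast_ne_zero (R := K).mpr n.factorial_ne_zero
  have := Nat.cast_add_one_ne_zero (R := K) n
  rw [coeff_derivative, expGenFun, expGenFun, coeff_mk, coeff_mk, Nat.factorial_succ]
  push_cast
  field_simp

theorem expGenFun_mul (a b : ℕ → K) :
    expGenFun a * expGenFun b =
      expGenFun fun n => ∑ k ∈ Finset.range (n + 1), n.choose k * a k * b (n - k) := by
  ext n
  have := Nat.cast_ne_zero (R := K).mpr n.factorial_ne_zero
  simp only [coeff_mul, expGenFun, coeff_mk, Finset.sum_div]
  rw [Finset.Nat.sum_antidiagonal_eq_sum_range_succ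
    fun i j => a i / (i.factorial : K) * (b j / (j.factorial : K))]
  refine Finset.sum_congr rfl fun k hk => ?_
  rw [Nat.cast_choose K (Finset.mem_range_succ_iff.mp hk)]
  field_simp

theorem constantCoeff_iterate_derivative_expGenFun (a : ℕ → K) (n : ℕ) :
    constantCoeff ((d⁄dX K)^[n] (expGenFun a)) = a n := by
  rw [constantCoeff_iterate_derivative, expGenFun, coeff_mk]
  exact mul_div_cancel₀ _ (Nat.cast_ne_zero.mpr n.factorial_ne_zero)

end ExponentialGeneratingFunction

section PseudoFactorial

/-- The exponential generating function `F` of the pseudo-factorials. -/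
noncomputable def pseudoFactorialEGF : ℚ⟦X⟧ := expGenFun fun n => (pseudoFactorial n : ℚ)

/-- The reflection `G(x) = F(-x)` of the exponential generating function of the
pseudo-factorials. -/
noncomputable def pseudoFactorialEGFNeg : ℚ⟦X⟧ := evalNegHom pseudoFactorialEGF

theorem constantCoeff_pseudoFactorialEGF : constantCoeff pseudoFactorialEGF = 1 := by
  simp [pseudoFactorialEGF, constantCoeff_expGenFun, pseudoFactorial_zero]

theorem constantCoeff_pseudoFactorialEGFNeg : constantCoeff pseudoFactorialEGFNeg = 1 := by
  simp [pseudoFactorialEGFNeg, pseudoFactorialEGF, evalNegHom, rescale_expGenFun,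
    constantCoeff_expGenFun, pseudoFactorial_zero]

theorem derivative_pseudoFactorialEGF :
    d⁄dX ℚ pseudoFactorialEGF = -pseudoFactorialEGFNeg ^ 2 := by
  rw [pseudoFactorialEGFNeg, ← map_pow, sq, pseudoFactorialEGF, derivative_expGenFun,
    expGenFun_mul, evalNegHom, rescale_expGenFun]
  ext n
  simp only [expGenFun, map_neg, coeff_mk, pseudoFactorial_succ]
  push_cast
  ring

theorem derivative_pseudoFactorialEGFNeg :
    d⁄dX ℚ pseudoFactorialEGFNeg = pseudoFactorialEGF ^ 2 := by
  rw [pseudoFactorialEGFNeg, evalNegHom, derivative_rescale, derivative_pseudoFactorialEGF,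
    pseudoFactorialEGFNeg, evalNegHom, map_neg, map_pow, rescale_rescale]
  simp

theorem pseudoFactorialEGF_cube_add_cube :
    pseudoFactorialEGF ^ 3 + pseudoFactorialEGFNeg ^ 3 = 2 := by
  apply derivative.ext
  · rw [derivation_cube_add_cube _ derivative_pseudoFactorialEGF derivative_pseudoFactorialEGFNeg]
    exact ((d⁄dX ℚ).map_natCast 2).symm
  · simp only [map_add, map_pow, constantCoeff_pseudoFactorialEGF,
      constantCoeff_pseudoFactorialEGFNeg, map_ofNat]
    norm_num

theorem pseudoFactorial_eq_stieltjesMatrix (n : ℕ) :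
    pseudoFactorial n = stieltjesMatrix fractionLinear fractionNumerator n 0 := by
  have moment := map_iterate_derivation_eq_stieltjesMatrix (d⁄dX ℚ) constantCoeff
    derivative_pseudoFactorialEGF derivative_pseudoFactorialEGFNeg pseudoFactorialEGF_cube_add_cube
    constantCoeff_pseudoFactorialEGF constantCoeff_pseudoFactorialEGFNeg n
  rw [pseudoFactorialEGF, constantCoeff_iterate_derivative_expGenFun] at moment
  exact_mod_cast moment

theorem det_pseudoFactorialHankel (m : ℕ) :
    (pseudoFactorialHankel m).det =
      ∏ k ∈ Finset.range m, ∏ j ∈ Finset.Icc 1 k, fractionNumerator j := by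
  simp only [pseudoFactorialHankel, pseudoFactorial_eq_stieltjesMatrix, det_hankel_stieltjesMatrix]

theorem prod_Icc_fractionNumerator (k : ℕ) :
    ∏ j ∈ Finset.Icc 1 k, fractionNumerator j =
      (-1) ^ k * 3 ^ ((k + 1) / 2) * (k.factorial : ℤ) ^ 2 := by
  induction k with
  | zero => simp
  | succ k ih =>
    have three_pow : (3 : ℤ) ^ ((k + 1 + 1) / 2) = 3 ^ ((k + 1) / 2) * (2 - (-1) ^ (k + 1)) := by
      rcases Nat.even_or_odd' k with ⟨r, rfl | rfl⟩
      · rw [show (2 * r + 1 + 1) / 2 = (2 * r + 1) / 2 + 1 by omega, Odd.neg_one_pow ⟨r, rfl⟩]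
        ring
      · rw [show (2 * r + 1 + 1 + 1) / 2 = (2 * r + 1 + 1) / 2 by omega,
          Even.neg_one_pow ⟨r + 1, by ring⟩]
        ring
    rw [Finset.prod_Icc_succ_top (by omega), ih, fractionNumerator, Nat.factorial_succ, three_pow]
    push_cast
    ring

end PseudoFactorial

theorem mainTheorem7 (m : ℕ) (hm : 0 < m) :
    (pseudoFactorialHankel m).det =
        ∏ j ∈ Finset.Icc 1 (m - 1), fractionNumerator j ^ (m - j) ∧
      (pseudoFactorialHankel m).det =
        (-1) ^ (m / 2) * 3 ^ (m ^ 2 / 4) *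
          (∏ k ∈ Finset.Icc 1 (m - 1), (Nat.factorial k : ℤ)) ^ 2 := by
  rw [det_pseudoFactorialHankel]
  refine ⟨prod_range_prod_Icc fractionNumerator m, ?_⟩
  simp only [prod_Icc_fractionNumerator, Finset.prod_mul_distrib, Finset.prod_pow,
    Finset.prod_pow_eq_pow_sum, prod_range_neg_one_pow, sum_range_succ_div_two]
  rw [← Nat.cast_prod, prod_range_factorial hm, Nat.cast_prod]
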